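/- Let $X$ be a complete metric space with metric $d$ and let $G$ be a local semiflow on $X$: a continuous map $(t,x)\mapsto G(t)x$ from an open set $D\subset[0,\infty)\times X$ to $X$ such that for every $x\in X$ there is an escape time $T_x\in(0,\infty]$ with $(t,x)\in D\iff 0\le t<T_x$, such that $G(0)x=x$, and such that whenever $(t+s,x)\in D$ with $t,s\ge 0$, also $(t,G(s)x)\in D$ and $G(t+s)x=G(t)G(s)x$. For $J\subset[0,\infty)$ and $M\subset X$ write $G(J)M=\{G(t)x: x\in M,\ t\in J\cap[0,T_x)\}$, and $G(t)M=G(\{t\})M$. A set $M$ is *invariant* if $G(t)M=M$ for all $t\ge0$. For $A\subset X$ and $x\in A$ put $t_A(x)=\sup\{0\le t\le T_x: G([0,t])x\subset A\}$. A set $M\subset X$ is *strongly admissible* if (i) for all sequences $x_n\in M$ and $t_n\to\infty$ with $t_n<T_{x_n}$ and $G([0,t_n])x_n\subset M$, the sequence $G(t_n)x_n$ has a subsequence that converges in $X$, and (ii) $T_x=\infty$ whenever $G([0,T_x))x\subset M$. $G$ is *asymptotically compact* in $A\subset X$ if every bounded $B\subset A$ is strongly admissible. $G$ is *stable at infinity*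 in $A\subset X$ if for every bounded $B_0\subset X$ there is a bounded $B_1\subset X$ such that $G(t)x\notin B_0$ for all $x\in A\setminus B_1$ and all $t\in[0,t_A(x))$. A pair $(N,E)$ of closed subsets of $X$ is a *Ważewski pair* if $E$ is an exit set of $N$, that is, (a) for all $x\in N\cap E$ and $t>0$, $G([0,t))x\subset N$ implies $G([0,t))x\subset E$; and (b) for all $x\in N\setminus E$, if $t_{N\setminus E}(x)<T_x$ then $G(t_{N\setminus E}(x))x\in E$. For $L,Q\subset X$ and a family $\Gamma$ of continuous maps from $Q$ to $X$, $L$ *links* $Q$ with respect to $\Gamma$ if $L\cap h(Q)\neq\emptyset$ for every $h\in\Gamma$. **Theorem.** Let $(N,E)$ be a Ważewski pair, $H=\overline{N\setminus E}$ and $W=N\cup E$, and let $G$ be asymptotically compact and stable at infinity in $H$. Suppose that there is a bounded closed set $L\subset N$ with $L\cap E=\emptyset$ satisfying the linking hypothesis (LH) for every bounded $B\subset H$ there are sets $S\subset Q\subset W$ with $S\subset E\cup(H\setminus B)$ such that $L$ links $Q$ with respect to $\{h\in C(Q,W): h|_S=\mathrm{id}_S\}$. Then $H$ contains a nonempty compact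 invariant set. -/

import Mathlib

open scoped NNReal ENNReal Topology

/-- A local semiflow on `X`: a continuous map `(t, x) ↦ G(t)x` defined on an open subset
`D = {(t, x) | t < T x}` of `[0, ∞) × X`, with escape times `T x ∈ (0, ∞]`, such that `G(0)x = x`
and, whenever `(t + s, x) ∈ D`, also `(t, G(s)x) ∈ D` and `G(t + s)x = G(t)(G(s)x)`.
The function `flow` is total for convenience; its values outside `D` carry no meaning and no
definition below uses them. -/
structure LocalSemiflow (X : Type*) [TopologicalSpace X] where
  /-- the escape time `T x` -/
  escapeTime : X → ℝ≥0∞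
  /-- the map `(t, x) ↦ G(t)x` -/
  flow : ℝ≥0 → X → X
  escapeTime_pos : ∀ x, 0 < escapeTime x
  isOpen_domain : IsOpen {p : ℝ≥0 × X | (p.1 : ℝ≥0∞) < escapeTime p.2}
  continuousOn_flow : ContinuousOn (fun p : ℝ≥0 × X => flow p.1 p.2)
    {p : ℝ≥0 × X | (p.1 : ℝ≥0∞) < escapeTime p.2}
  flow_zero : ∀ x, flow 0 x = x
  lt_escapeTime_flow : ∀ (t s : ℝ≥0) (x : X), ((t + s : ℝ≥0) : ℝ≥0∞) < escapeTime x →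
    (t : ℝ≥0∞) < escapeTime (flow s x)
  flow_add : ∀ (t s : ℝ≥0) (x : X), ((t + s : ℝ≥0) : ℝ≥0∞) < escapeTime x →
    flow (t + s) x = flow t (flow s x)

namespace LocalSemiflow

section Topological

variable {X : Type*} [TopologicalSpace X] (G : LocalSemiflow X)

/-- `G(J)M = {G(t)x | x ∈ M, t ∈ J ∩ [0, T x)}`. -/
def image (J : Set ℝ≥0) (M : Set X) : Set X :=
  {y | ∃ x ∈ M, ∃ t ∈ J, (t : ℝ≥0∞) < G.escapeTime x ∧ G.flow t x = y}

/-- `M` is invariant: `G(t)M = M` for all `t ≥ 0`. -/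
def IsInvariant (M : Set X) : Prop :=
  ∀ t : ℝ≥0, G.image {t} M = M

/-- `G` does not explode in `M`: `T x = ∞` whenever `G([0, T x))x ⊆ M`. -/
def NotExplodeIn (M : Set X) : Prop :=
  ∀ x, G.image Set.univ {x} ⊆ M → G.escapeTime x = ∞

/-- `M` is admissible: for all sequences `x n ∈ M` and `t n → ∞` with `G([0, t n])(x n) ⊆ M`,
the sequence `G(t n)(x n)` (whose terms have to be defined) has a convergent subsequence. -/
def Admissible (M : Set X) : Prop :=
  ∀ (x : ℕ → X) (t : ℕ → ℝ≥0), (∀ n, x n ∈ M) → Filter.Tendsto t Filter.atTop Filter.atTop →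
    (∀ n, (t n : ℝ≥0∞) < G.escapeTime (x n)) → (∀ n, G.image (Set.Icc 0 (t n)) {x n} ⊆ M) →
    ∃ (y : X) (k : ℕ → ℕ), StrictMono k ∧
      Filter.Tendsto (fun n => G.flow (t (k n)) (x (k n))) Filter.atTop (𝓝 y)

/-- `M` is strongly admissible: admissible, and `G` does not explode in `M`. -/
def StronglyAdmissible (M : Set X) : Prop :=
  G.Admissible M ∧ G.NotExplodeIn M

/-- The escape time `t_A(x) = sup {0 ≤ t ≤ T x | G([0, t])x ⊆ A}` of `x` in `A`. -/
noncomputable def exitTime (A : Set X) (x : X) : ℝ≥0∞ :=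
  sSup {t : ℝ≥0∞ | t ≤ G.escapeTime x ∧ G.image {s : ℝ≥0 | (s : ℝ≥0∞) ≤ t} {x} ⊆ A}

/-- `E` is `N`-invariant: for `x ∈ N ∩ E` and `t > 0`, `G([0, t))x ⊆ N` implies
`G([0, t))x ⊆ E`. -/
def InvariantRel (N E : Set X) : Prop :=
  ∀ x ∈ N ∩ E, ∀ t : ℝ≥0, 0 < t →
    G.image (Set.Ico 0 t) {x} ⊆ N → G.image (Set.Ico 0 t) {x} ⊆ E

/-- `E` is an exit set of `N`: it is `N`-invariant, and for each `x ∈ N \ E` with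
`t_{N \ E}(x) < T x`, the point `G(t_{N \ E}(x))x` lies in `E`. -/
def IsExitSet (N E : Set X) : Prop :=
  G.InvariantRel N E ∧
    ∀ x ∈ N \ E, ∀ t : ℝ≥0, (t : ℝ≥0∞) = G.exitTime (N \ E) x →
      (t : ℝ≥0∞) < G.escapeTime x → G.flow t x ∈ E

/-- `(N, E)` is a Ważewski pair: `N` and `E` are closed and `E` is an exit set of `N`. -/
def IsWazewskiPair (N E : Set X) : Prop :=
  IsClosed N ∧ IsClosed E ∧ G.IsExitSet N E

end Topological

section Metric

variable {X : Type*} [MetricSpace X] (G : LocalSemiflow X)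

/-- `G` is asymptotically compact in `A`: every bounded `B ⊆ A` is strongly admissible. -/
def AsymptoticallyCompactIn (A : Set X) : Prop :=
  ∀ B ⊆ A, Bornology.IsBounded B → G.StronglyAdmissible B

/-- `G` is stable at infinity in `A`: for each bounded `B₀` there is a bounded `B₁` such that
`G(t)x ∉ B₀` for all `x ∈ A \ B₁` and `0 ≤ t < t_A(x)`. -/
def StableAtInfinityIn (A : Set X) : Prop :=
  ∀ B₀ : Set X, Bornology.IsBounded B₀ → ∃ B₁ : Set X, Bornology.IsBounded B₁ ∧
    ∀ x ∈ A \ B₁, ∀ t : ℝ≥0, (t : ℝ≥0∞) < G.exitTime A x → G.flow t x ∉ B₀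

end Metric

end LocalSemiflow

/-- `L` links `Q` with respect to the family `Γ` of continuous maps from `Q` to `X`. -/
def Links {X : Type*} [TopologicalSpace X] (L Q : Set X) (Γ : Set C(Q, X)) : Prop :=
  ∀ h ∈ Γ, (L ∩ Set.range h).Nonempty

/-- The family `{h ∈ C(Q, W) | h restricted to S is the identity}`; a member is a continuous map
from the subspace `Q` to `X` with values in `W`. -/
def linkFamily {X : Type*} [TopologicalSpace X] (Q W S : Set X) : Set C(Q, X) :=
  {h | (∀ q : Q, h q ∈ W) ∧ ∀ q : Q, (q : X) ∈ S → h q = (q : X)}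

/-!
The proof is by contradiction: if `closure (N \ E)` contains no nonempty compact invariant set, then
flowing along `G` for a continuously varying time deforms `Q` off `L` and fixes `S`, contradicting
the linking hypothesis.

* An orbit that stays in a bounded subset of `H = closure (N \ E)` for ever has a compact invariant
  ω-limit set (`LocalSemiflow.exists_isInvariant_of_forall_flow_mem`), and a sequence of orbit pieces
  of unbounded length in such a set produces such an orbit, starting at a limit of the midpoints. So
  without compact invariant sets the lengths are bounded
  (`LocalSemiflow.exists_isInvariant_or_staysIn_le`).
* Let `P` be the set of all `(x, s)` such that the orbit of `x` stays in `N \ E` during `[0, s]` and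
  is in `L` at time `s`. By stability at infinity these orbit pieces lie in one bounded set, so `s`
  is bounded on `P`. Moreover `P` is closed (`LocalSemiflow.isClosed_visits`): a limit orbit that
  meets `E` while still in `N` remains in `E` up to its visit to `L`, which is disjoint from `E`.
* Hence the set `K` of the `x` with some `(x, s) ∈ P` is closed, bounded and disjoint from `E`. Each
  `x ∈ K` has a last visit to `L` and leaves `N \ E` strictly later; a time between the two serves
  for all nearby points too. Off `K` the time `0` serves. A partition of unity glues these local
  choices to a continuous time function vanishing on `E` and outside a bounded neighbourhood of `K`
  (`LocalSemiflow.exists_pushing_time`).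

The exit time from `N \ E` itself need not be continuous, which is why the flow is stopped before
`E` is reached.
-/

open Filter Set

namespace LocalSemiflow

/-! ### Orbit pieces and exit times -/

section Topological

variable {X : Type*} [TopologicalSpace X] (G : LocalSemiflow X)

/-- The orbit of `x` is defined and contained in `A` during the closed time interval `[0, t]`. -/
def StaysIn (A : Set X) (x : X) (t : ℝ≥0) : Prop :=
  (t : ℝ≥0∞) < G.escapeTime x ∧ ∀ s ≤ t, G.flow s x ∈ A

/-- The pairs `(x, s)` such that the orbit of `x` stays in `A` during `[0, s]` and is in `L` at
time `s`. -/
def visits (A L : Set X) : Set (X × ℝ≥0) :=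
  {p | G.StaysIn A p.1 p.2 ∧ G.flow p.2 p.1 ∈ L}

variable {G}

theorem image_singleton_subset_iff {J : Set ℝ≥0} {x : X} {A : Set X} :
    G.image J {x} ⊆ A ↔ ∀ t ∈ J, (t : ℝ≥0∞) < G.escapeTime x → G.flow t x ∈ A := by
  constructor
  · intro h t ht hlt
    exact h ⟨x, rfl, t, ht, hlt, rfl⟩
  · rintro h _ ⟨y, rfl, t, ht, hlt, rfl⟩
    exact h t ht hlt

theorem StaysIn.lt {A : Set X} {x : X} {s t : ℝ≥0} (h : G.StaysIn A x t) (hs : s ≤ t) :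
    (s : ℝ≥0∞) < G.escapeTime x :=
  (ENNReal.coe_le_coe.2 hs).trans_lt h.1

theorem StaysIn.of_le {A : Set X} {x : X} {s t : ℝ≥0} (h : G.StaysIn A x t) (hs : s ≤ t) :
    G.StaysIn A x s :=
  ⟨h.lt hs, fun r hr => h.2 r (hr.trans hs)⟩

theorem StaysIn.mono {A B : Set X} {x : X} {t : ℝ≥0} (h : G.StaysIn A x t) (hAB : A ⊆ B) :
    G.StaysIn B x t :=
  ⟨h.1, fun r hr => hAB (h.2 r hr)⟩

theorem StaysIn.mem {A : Set X} {x : X} {t : ℝ≥0} (h : G.StaysIn A x t) : x ∈ A := by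
  simpa [G.flow_zero] using h.2 0 zero_le

theorem StaysIn.flow {A : Set X} {x : X} {r s : ℝ≥0} (h : G.StaysIn A x (s + r)) :
    G.StaysIn A (G.flow r x) s := by
  refine ⟨G.lt_escapeTime_flow s r x h.1, fun q hq => ?_⟩
  have hqr : q + r ≤ s + r := by gcongr
  rw [← G.flow_add q r x (h.lt hqr)]
  exact h.2 _ hqr

theorem tendsto_flow {ι : Type*} {l : Filter ι} {u : ι → X} {t : ι → ℝ≥0} {x : X} {s : ℝ≥0}
    (hu : Tendsto u l (𝓝 x)) (ht : Tendsto t l (𝓝 s)) (hs : (s : ℝ≥0∞) < G.escapeTime x) :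
    Tendsto (fun i => G.flow (t i) (u i)) l (𝓝 (G.flow s x)) := by
  have hc : ContinuousAt (fun p : ℝ≥0 × X => G.flow p.1 p.2) (s, x) :=
    G.continuousOn_flow.continuousAt (G.isOpen_domain.mem_nhds hs)
  exact Tendsto.comp (y := 𝓝 (s, x)) (g := fun p : ℝ≥0 × X => G.flow p.1 p.2)
    (f := fun i => (t i, u i)) hc (ht.prodMk_nhds hu)

theorem lt_exitTime_iff {A : Set X} {x : X} {c : ℝ≥0} :
    (c : ℝ≥0∞) < G.exitTime A x ↔ ∃ t, c < t ∧ G.StaysIn A x t := by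
  constructor
  · intro h
    obtain ⟨τ, ⟨hτ, hA⟩, hc⟩ := lt_sSup_iff.1 h
    obtain ⟨b, hb1, hb2⟩ := ENNReal.lt_iff_exists_nnreal_btwn.1 hc
    refine ⟨b, by exact_mod_cast hb1, hb2.trans_le hτ, fun s hs => ?_⟩
    have hsb : (s : ℝ≥0∞) < τ := (ENNReal.coe_le_coe.2 hs).trans_lt hb2
    exact image_singleton_subset_iff.1 hA s hsb.le (hsb.trans_le hτ)
  · rintro ⟨t, hct, ht⟩
    refine (ENNReal.coe_lt_coe.2 hct).trans_le (le_sSup ⟨ht.1.le, ?_⟩)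
    exact image_singleton_subset_iff.2 fun s hs _ => ht.2 s (ENNReal.coe_le_coe.1 hs)

theorem StaysIn.le_exitTime {A : Set X} {x : X} {t : ℝ≥0} (h : G.StaysIn A x t) :
    (t : ℝ≥0∞) ≤ G.exitTime A x :=
  le_sSup ⟨h.1.le, image_singleton_subset_iff.2 fun s hs _ => h.2 s (ENNReal.coe_le_coe.1 hs)⟩

theorem NotExplodeIn.escapeTime_eq_top {B : Set X} (hB : G.NotExplodeIn B) {x : X}
    (h : ∀ t : ℝ≥0, (t : ℝ≥0∞) < G.escapeTime x → G.flow t x ∈ B) : G.escapeTime x = ∞ :=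
  hB x (image_singleton_subset_iff.2 fun t _ ht => h t ht)

/-- If arbitrarily long orbit pieces in a closed set `B` start closer and closer to `x`, then the
orbit of `x` never leaves `B`. -/
theorem flow_mem_of_tendsto {B : Set X} (hB : IsClosed B) (hne : G.NotExplodeIn B)
    {u : ℕ → X} {t : ℕ → ℝ≥0} {x : X} (hu : Tendsto u atTop (𝓝 x))
    (ht : Tendsto t atTop atTop) (h : ∀ n, G.StaysIn B (u n) (t n)) :
    G.escapeTime x = ∞ ∧ ∀ s, G.flow s x ∈ B := by
  have key : ∀ s : ℝ≥0, (s : ℝ≥0∞) < G.escapeTime x → G.flow s x ∈ B := fun s hs =>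
    hB.mem_of_tendsto (tendsto_flow hu tendsto_const_nhds hs)
      ((ht.eventually_ge_atTop s).mono fun n hn => (h n).2 s hn)
  have htop := hne.escapeTime_eq_top key
  exact ⟨htop, fun s => key s (htop ▸ ENNReal.coe_lt_top)⟩

end Topological

/-! ### Orbits in the complement of an exit set -/

section Exit

variable {X : Type*} [TopologicalSpace X] {G : LocalSemiflow X} {N E : Set X}

/-- An orbit that has not entered the exit set at time `t` stays in `N \ E` a little longer. -/
theorem IsExitSet.lt_exitTime (h : G.IsExitSet N E) {x : X} {t : ℝ≥0}
    (hx : G.StaysIn (N \ E) x t) : (t : ℝ≥0∞) < G.exitTime (N \ E) x := by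
  refine lt_of_le_of_ne hx.le_exitTime fun heq => ?_
  exact (hx.2 t le_rfl).2 (h.2 x hx.mem t heq hx.1)

/-- An orbit can leave `N \ E` only through `E`. -/
theorem IsExitSet.staysIn_of_flow_notMem (h : G.IsExitSet N E) {x : X} {t : ℝ≥0}
    (hx : x ∈ N \ E) (ht : ∀ s ≤ t, (s : ℝ≥0∞) < G.escapeTime x ∧ G.flow s x ∉ E) :
    G.StaysIn (N \ E) x t := by
  by_cases hlt : (t : ℝ≥0∞) < G.exitTime (N \ E) x
  · obtain ⟨s, hs, hst⟩ := lt_exitTime_iff.1 hlt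
    exact hst.of_le hs.le
  · obtain ⟨r, hr, hrt⟩ := ENNReal.le_coe_iff.1 (not_lt.1 hlt)
    exact absurd (h.2 x hx r hr.symm (ht r hrt).1) (ht r hrt).2

theorem IsExitSet.eventually_staysIn (h : G.IsExitSet N E) (hE : IsClosed E) {x : X} {t : ℝ≥0}
    (hx : G.StaysIn (N \ E) x t) : ∀ᶠ y in 𝓝 x, y ∈ N \ E → G.StaysIn (N \ E) y t := by
  have hev : ∀ᶠ y in 𝓝 x, ∀ s ∈ Icc 0 t, (s : ℝ≥0∞) < G.escapeTime y ∧ G.flow s y ∉ E := by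
    refine isCompact_Icc.eventually_forall_of_forall_eventually fun s hs => ?_
    have h1 : ∀ᶠ p : X × ℝ≥0 in 𝓝 (x, s), (p.2 : ℝ≥0∞) < G.escapeTime p.1 :=
      (continuous_swap.tendsto (x, s)).eventually
        (G.isOpen_domain.mem_nhds (show (s, x) ∈ _ from hx.lt hs.2))
    have hlim : Tendsto (fun p : X × ℝ≥0 => G.flow p.2 p.1) (𝓝 (x, s)) (𝓝 (G.flow s x)) :=
      tendsto_flow continuousAt_fst continuousAt_snd (hx.lt hs.2)
    have h2 : ∀ᶠ p : X × ℝ≥0 in 𝓝 (x, s), G.flow p.2 p.1 ∉ E :=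
      hlim.eventually (hE.isOpen_compl.eventually_mem (hx.2 s hs.2).2)
    exact h1.and h2
  exact hev.mono fun y hy hyN => h.staysIn_of_flow_notMem hyN fun s hs => hy s ⟨zero_le, hs⟩

/-- An orbit that stays in `N` and is outside `E` at the final time has never been in `E`. -/
theorem InvariantRel.staysIn_diff (h : G.InvariantRel N E) (hE : IsClosed E) {x : X} {t : ℝ≥0}
    (hx : G.StaysIn N x t) (ht : G.flow t x ∉ E) : G.StaysIn (N \ E) x t := by
  refine ⟨hx.1, fun r hr => ⟨hx.2 r hr, fun hrE => ht ?_⟩⟩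
  obtain rfl | hlt := hr.eq_or_lt
  · exact hrE
  obtain ⟨s, rfl⟩ := exists_add_of_le hr
  rw [add_comm] at hx ht ⊢
  have hs : 0 < s := by simpa using hlt
  have hN := hx.flow
  have hsub := image_singleton_subset_iff.1 <| h _ ⟨hx.2 r le_add_self, hrE⟩ s hs <|
    image_singleton_subset_iff.2 fun q hq _ => hN.2 q hq.2.le
  rw [G.flow_add s r x hx.1]
  -- `E`-invariance covers the half-open interval `[0, s)`; the endpoint is a limit of it.
  have hcl : s ∈ closure (Iio s) := by
    rw [closure_Iio' (a := s) ⟨0, hs⟩]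
    exact self_mem_Iic
  have : (𝓝[<] s).NeBot := mem_closure_iff_nhdsWithin_neBot.1 hcl
  refine hE.mem_of_tendsto (b := 𝓝[<] s)
    (tendsto_flow tendsto_const_nhds (tendsto_id.mono_left nhdsWithin_le_nhds) hN.1) ?_
  filter_upwards [self_mem_nhdsWithin] with q hq
  exact hsub q ⟨zero_le, hq⟩ (hN.lt (le_of_lt hq))

end Exit

/-! ### Compact invariant sets as ω-limit sets -/

section Metric

variable {X : Type*} [MetricSpace X] {G : LocalSemiflow X}

/-- The ω-limit set of an orbit that stays for ever in a closed strongly admissible set is a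
nonempty compact invariant set. -/
theorem exists_isInvariant_of_forall_flow_mem {B : Set X} (hB : IsClosed B)
    (hadm : G.StronglyAdmissible B) {z : X} (hz : G.escapeTime z = ∞)
    (hzB : ∀ t, G.flow t z ∈ B) :
    ∃ M ⊆ B, M.Nonempty ∧ IsCompact M ∧ G.IsInvariant M := by
  have hstay : ∀ t, G.StaysIn B z t := fun t => ⟨hz ▸ ENNReal.coe_lt_top, fun s _ => hzB s⟩
  have hsub : ∀ t : ℕ → ℝ≥0, Tendsto t atTop atTop → ∃ (y : X) (k : ℕ → ℕ), StrictMono k ∧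
      Tendsto (fun n => G.flow (t (k n)) z) atTop (𝓝 y) := fun t ht =>
    hadm.1 (fun _ => z) t (fun _ => (hstay 0).mem) ht (fun n => (hstay (t n)).1)
      fun n => image_singleton_subset_iff.2 fun s _ _ => hzB s
  let M : Set X := {y | ∃ t : ℕ → ℝ≥0, Tendsto t atTop atTop ∧
    Tendsto (fun n => G.flow (t n) z) atTop (𝓝 y)}
  have hM : ∀ y ∈ M, G.escapeTime y = ∞ ∧ ∀ s, G.flow s y ∈ B := by
    rintro y ⟨t, -, hy⟩
    exact flow_mem_of_tendsto hB hadm.2 hy (tendsto_natCast_atTop_atTop (R := ℝ≥0))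
      fun n => (hstay ((n : ℝ≥0) + t n)).flow
  have hflow : ∀ y ∈ M, ∀ s : ℝ≥0, (s : ℝ≥0∞) < G.escapeTime y := fun y hy s =>
    (hM y hy).1 ▸ ENNReal.coe_lt_top
  refine ⟨M, fun y hy => ?_, ?_, ?_, fun s => Subset.antisymm ?_ fun y hy => ?_⟩
  · simpa [G.flow_zero] using (hM y hy).2 0
  · obtain ⟨y, k, hk, hy⟩ := hsub (fun n => (n : ℝ≥0)) tendsto_natCast_atTop_atTop
    exact ⟨y, _, (tendsto_natCast_atTop_atTop (R := ℝ≥0)).comp hk.tendsto_atTop, hy⟩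
  · refine IsSeqCompact.isCompact fun y hy => ?_
    have hex : ∀ n : ℕ, ∃ t : ℝ≥0, (n : ℝ≥0) ≤ t ∧ dist (G.flow t z) (y n) < 1 / ((n : ℝ) + 1) := by
      intro n
      obtain ⟨t, ht, hyn⟩ := hy n
      obtain ⟨m, hm1, hm2⟩ := ((ht.eventually_ge_atTop (n : ℝ≥0)).and
        (hyn.eventually (Metric.ball_mem_nhds _ (Nat.one_div_pos_of_nat (n := n))))).exists
      exact ⟨t m, hm1, hm2⟩
    choose t ht hty using hex
    have htop : Tendsto t atTop atTop :=
      tendsto_atTop_mono ht (tendsto_natCast_atTop_atTop (R := ℝ≥0))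
    obtain ⟨a, k, hk, ha⟩ := hsub t htop
    refine ⟨a, ⟨_, htop.comp hk.tendsto_atTop, ha⟩, k, hk, ?_⟩
    refine ha.congr_dist ?_
    have hd : Tendsto (fun n => dist (G.flow (t n) z) (y n)) atTop (𝓝 0) :=
      squeeze_zero (fun _ => dist_nonneg) (fun n => (hty n).le)
        tendsto_one_div_add_atTop_nhds_zero_nat
    exact hd.comp hk.tendsto_atTop
  · rintro _ ⟨y, hy, r, hr, hlt, rfl⟩
    rw [mem_singleton_iff.1 hr] at hlt ⊢
    obtain ⟨t, ht, hyt⟩ := hy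
    refine ⟨fun n => s + t n, tendsto_atTop_mono (fun _ => le_add_self) ht, ?_⟩
    refine (tendsto_flow hyt (tendsto_const_nhds (x := s)) hlt).congr fun n => ?_
    exact (G.flow_add s (t n) z (hstay _).1).symm
  · obtain ⟨t, ht, hyt⟩ := hy
    have ht' : Tendsto (fun n => t n - s) atTop atTop :=
      tendsto_atTop.2 fun b => (ht.eventually_ge_atTop (b + s)).mono fun n hn =>
        le_tsub_of_add_le_right hn
    obtain ⟨w, k, hk, hw⟩ := hsub _ ht'
    have hwM : w ∈ M := ⟨_, ht'.comp hk.tendsto_atTop, hw⟩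
    refine ⟨w, hwM, s, rfl, hflow w hwM s, ?_⟩
    refine tendsto_nhds_unique (tendsto_flow hw (tendsto_const_nhds (x := s)) (hflow w hwM s)) ?_
    refine (hyt.comp hk.tendsto_atTop).congr' ?_
    filter_upwards [(ht.comp hk.tendsto_atTop).eventually_ge_atTop s] with n hn
    have hn' : s ≤ t (k n) := hn
    rw [← G.flow_add s _ z (hstay _).1, add_tsub_cancel_of_le hn']
    rfl

/-- Either a closed strongly admissible set contains a nonempty compact invariant set, or the
lengths of the orbit pieces contained in it are bounded. -/
theorem exists_isInvariant_or_staysIn_le {B : Set X} (hB : IsClosed B)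
    (hadm : G.StronglyAdmissible B) :
    (∃ M ⊆ B, M.Nonempty ∧ IsCompact M ∧ G.IsInvariant M) ∨
      ∃ T : ℝ≥0, ∀ x t, G.StaysIn B x t → t ≤ T := by
  refine or_iff_not_imp_right.2 fun h => ?_
  push Not at h
  -- The two halves of the time intervals serve different purposes: the first makes the midpoints
  -- converge, the second shows that the orbit of their limit never leaves `B`.
  choose u t ht hlt using fun n : ℕ => h ((n : ℝ≥0) + n)
  have hst : ∀ n : ℕ, G.StaysIn B (u n) ((n : ℝ≥0) + n) := fun n => (ht n).of_le (hlt n).le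
  have hn : ∀ n : ℕ, G.StaysIn B (u n) n := fun n => (hst n).of_le le_self_add
  obtain ⟨z, k, hk, hz⟩ := hadm.1 u (fun n => (n : ℝ≥0)) (fun n => (hn n).mem)
    tendsto_natCast_atTop_atTop (fun n => (hn n).1)
    fun n => image_singleton_subset_iff.2 fun s hs _ => (hn n).2 s hs.2
  obtain ⟨hz1, hz2⟩ := flow_mem_of_tendsto hB hadm.2 hz
    ((tendsto_natCast_atTop_atTop (R := ℝ≥0)).comp hk.tendsto_atTop) fun n => (hst (k n)).flow
  exact exists_isInvariant_of_forall_flow_mem hB hadm hz1 hz2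

/-! ### Visits to a bounded closed set -/

variable {N E L : Set X}

/-- By stability at infinity, the orbit pieces in `N \ E` that end in a bounded set `L` all lie in
one bounded set. -/
theorem exists_isBounded_staysIn (hex : G.IsExitSet N E)
    (hst : G.StableAtInfinityIn (closure (N \ E))) (hL : Bornology.IsBounded L) :
    ∃ B ⊆ closure (N \ E), IsClosed B ∧ Bornology.IsBounded B ∧
      ∀ p ∈ G.visits (N \ E) L, G.StaysIn B p.1 p.2 := by
  obtain ⟨B₁, hB₁, h⟩ := hst L hL
  refine ⟨closure (N \ E) ∩ closure B₁, inter_subset_left, isClosed_closure.inter isClosed_closure,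
    hB₁.closure.subset inter_subset_right, ?_⟩
  rintro ⟨x, s⟩ ⟨hx, hs⟩
  refine ⟨hx.1, fun r hr => ⟨subset_closure (hx.2 r hr), ?_⟩⟩
  by_contra hcon
  obtain ⟨q, rfl⟩ := exists_add_of_le hr
  rw [add_comm] at hx hs
  dsimp only at hx hs
  obtain ⟨t, hqt, ht⟩ := lt_exitTime_iff.1 (hex.lt_exitTime hx.flow)
  refine h (G.flow r x) ⟨subset_closure (hx.2 r le_add_self), fun hr' => hcon (subset_closure hr')⟩
    q (lt_exitTime_iff.2 ⟨t, hqt, ht.mono subset_closure⟩) ?_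
  rwa [← G.flow_add q r x hx.1]

theorem isClosed_visits (hE : IsClosed E) (hex : G.IsExitSet N E) (hLc : IsClosed L)
    (hLN : L ⊆ N) (hLE : L ∩ E = ∅) {B : Set X} (hB : IsClosed B)
    (hBN : B ⊆ N) (hne : G.NotExplodeIn B)
    (hvis : ∀ p ∈ G.visits (N \ E) L, G.StaysIn B p.1 p.2) :
    IsClosed (G.visits (N \ E) L) := by
  refine IsSeqClosed.isClosed ?_
  rintro u ⟨x, s⟩ hu hlim
  have hx : Tendsto (fun n => (u n).1) atTop (𝓝 x) := (continuous_fst.tendsto _).comp hlim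
  have hs : Tendsto (fun n => (u n).2) atTop (𝓝 s) := (continuous_snd.tendsto _).comp hlim
  have hr : ∀ r < s, (r : ℝ≥0∞) < G.escapeTime x → G.flow r x ∈ B := fun r hrs hrx =>
    hB.mem_of_tendsto (tendsto_flow hx tendsto_const_nhds hrx)
      ((hs.eventually (lt_mem_nhds hrs)).mono fun n hn => (hvis _ (hu n)).2 r hn.le)
  have hsx : (s : ℝ≥0∞) < G.escapeTime x := by
    by_contra hcon
    have htop := hne.escapeTime_eq_top fun r hrx =>
      hr r (ENNReal.coe_lt_coe.1 (hrx.trans_le (not_lt.1 hcon))) hrx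
    exact hcon (htop ▸ ENNReal.coe_lt_top)
  have hsL : G.flow s x ∈ L :=
    hLc.mem_of_tendsto (tendsto_flow hx hs hsx) (Eventually.of_forall fun n => (hu n).2)
  have hsN : G.StaysIn N x s := by
    refine ⟨hsx, fun r hrs => ?_⟩
    obtain rfl | hlt := hrs.eq_or_lt
    · exact hLN hsL
    · exact hBN (hr r hlt ((ENNReal.coe_lt_coe.2 hlt).trans hsx))
  exact ⟨hex.1.staysIn_diff hE hsN fun hsE => hLE.subset ⟨hsL, hsE⟩, hsL⟩

/-! ### Continuous choice of the flow time -/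

/-- There is a continuous time function, zero on `E` and off `V`, such that the
orbit of each point of `V ∩ (N \ E)` is still in `N \ E` at that time and does not visit `L` from
then on before leaving `N \ E`. -/
theorem exists_pushing_time (hE : IsClosed E) (hex : G.IsExitSet N E)
    (hP : IsClosed (G.visits (N \ E) L)) {T : ℝ≥0} (hT : ∀ p ∈ G.visits (N \ E) L, p.2 ≤ T)
    {V : Set X} (hV : IsOpen V) (hKV : ∀ p ∈ G.visits (N \ E) L, p.1 ∈ V) :
    ∃ σ : C(X, ℝ≥0), (∀ x ∈ E ∪ Vᶜ, σ x = 0) ∧ ∀ x ∈ N \ E, x ∈ V →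
      G.StaysIn (N \ E) x (σ x) ∧ ∀ s, σ x ≤ s → (x, s) ∉ G.visits (N \ E) L := by
  -- The permitted times at `x`; only for `x ∈ V ∩ (N \ E)` is there a choice.
  let C : X → Set ℝ := fun x => {c | (x ∈ E ∪ Vᶜ → c = 0) ∧ (x ∈ N \ E → x ∈ V → 0 ≤ c ∧
    G.StaysIn (N \ E) x c.toNNReal ∧ ∀ s, c.toNNReal ≤ s → (x, s) ∉ G.visits (N \ E) L)}
  have hconv : ∀ x, Convex ℝ (C x) := by
    refine fun x => Set.OrdConnected.convex ⟨fun a ha b hb c hc => ⟨fun hx => ?_, fun hx hxV => ?_⟩⟩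
    · exact le_antisymm (hc.2.trans (hb.1 hx).le) ((ha.1 hx).ge.trans hc.1)
    · obtain ⟨ha0, -, ha⟩ := ha.2 hx hxV
      obtain ⟨-, hb, -⟩ := hb.2 hx hxV
      exact ⟨ha0.trans hc.1, hb.of_le (Real.toNNReal_le_toNNReal hc.2),
        fun s hs => ha s ((Real.toNNReal_le_toNNReal hc.1).trans hs)⟩
  have hopen : ∀ (c : ℝ≥0) (x : X), (∀ s, c ≤ s → (x, s) ∉ G.visits (N \ E) L) →
      ∀ᶠ y in 𝓝 x, ∀ s, c ≤ s → (y, s) ∉ G.visits (N \ E) L := by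
    intro c x hx
    have := isCompact_Icc.eventually_forall_of_forall_eventually (K := Icc c T)
      (P := fun y s => (y, s) ∉ G.visits (N \ E) L)
      fun s hs => hP.isOpen_compl.eventually_mem (hx s hs.1)
    exact this.mono fun y hy s hs hys => hy s ⟨hs, hT _ hys⟩ hys
  have hloc : ∀ x, ∃ c : ℝ, ∀ᶠ y in 𝓝 x, c ∈ C y := by
    intro x
    by_cases hx : ∃ s, (x, s) ∈ G.visits (N \ E) L
    · obtain ⟨s₀, hs₀⟩ := hx
      have hcomp : IsCompact {s | (x, s) ∈ G.visits (N \ E) L} :=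
        (isCompact_Icc (a := 0) (b := T)).of_isClosed_subset
          (hP.preimage (Continuous.prodMk_right x)) fun s hs => ⟨zero_le, hT _ hs⟩
      obtain ⟨m, hm, hmax⟩ := hcomp.exists_isGreatest ⟨s₀, hs₀⟩
      obtain ⟨c, hmc, hc⟩ := lt_exitTime_iff.1 (hex.lt_exitTime hm.1)
      refine ⟨c, ?_⟩
      filter_upwards [hex.eventually_staysIn hE hc, hV.mem_nhds (hKV _ hs₀),
        hE.isOpen_compl.mem_nhds hs₀.1.mem.2,
        hopen c x fun s hs hxs => (hmc.trans_le hs).not_ge (hmax hxs)] with y h1 hyV hyE h2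
      refine ⟨fun hy => (hy.elim hyE fun h => h hyV).elim, fun hy _ => ⟨c.2, ?_⟩⟩
      rw [Real.toNNReal_coe]
      exact ⟨h1 hy, h2⟩
    · push Not at hx
      refine ⟨0, ?_⟩
      filter_upwards [hopen 0 x fun s _ => hx s] with y hy
      refine ⟨fun _ => rfl, fun hyN _ => ⟨le_rfl, ?_⟩⟩
      rw [Real.toNNReal_zero]
      refine ⟨⟨G.escapeTime_pos y, fun s hs => ?_⟩, hy⟩
      rwa [nonpos_iff_eq_zero.1 hs, G.flow_zero]
  obtain ⟨g, hg⟩ := exists_continuous_forall_mem_convex_of_local_const hconv hloc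
  refine ⟨⟨fun x => (g x).toNNReal, by fun_prop⟩, fun x hx => ?_, fun x hx hxV =>
    ((hg x).2 hx hxV).2⟩
  change (g x).toNNReal = 0
  rw [(hg x).1 hx, Real.toNNReal_zero]

end Metric

end LocalSemiflow

/-! ### The linking theorem -/

theorem theorem4p4 {X : Type*} [MetricSpace X] [CompleteSpace X] (G : LocalSemiflow X)
    (N E : Set X) (hNE : G.IsWazewskiPair N E)
    (hac : G.AsymptoticallyCompactIn (closure (N \ E)))
    (hst : G.StableAtInfinityIn (closure (N \ E)))
    (L : Set X) (hLb : Bornology.IsBounded L) (hLc : IsClosed L) (hLN : L ⊆ N)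
    (hLE : L ∩ E = ∅)
    (hLH : ∀ B ⊆ closure (N \ E), Bornology.IsBounded B →
      ∃ S Q : Set X, S ⊆ Q ∧ Q ⊆ N ∪ E ∧ S ⊆ E ∪ (closure (N \ E) \ B) ∧
        Links L Q (linkFamily Q (N ∪ E) S)) :
    ∃ M ⊆ closure (N \ E), M.Nonempty ∧ IsCompact M ∧ G.IsInvariant M := by
  obtain ⟨hN, hE, hex⟩ := hNE
  have hHN : closure (N \ E) ⊆ N := closure_minimal sdiff_subset hN
  obtain ⟨B, hBH, hBc, hBb, hvis⟩ := LocalSemiflow.exists_isBounded_staysIn hex hst hLb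
  have hadm := hac B hBH hBb
  obtain ⟨M, hMB, hM⟩ | ⟨T, hT⟩ := LocalSemiflow.exists_isInvariant_or_staysIn_le hBc hadm
  · exact ⟨M, hMB.trans hBH, hM⟩
  exfalso
  have hP := LocalSemiflow.isClosed_visits hE hex hLc hLN hLE hBc (hBH.trans hHN) hadm.2 hvis
  -- `B` contains every point whose orbit visits `L` before leaving `N \ E`.
  obtain ⟨σ, hσ0, hσ⟩ := LocalSemiflow.exists_pushing_time hE hex hP
    (fun p hp => hT _ _ (hvis p hp)) (Metric.isOpen_thickening (δ := 1) (E := B))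
    fun p hp => Metric.self_subset_thickening one_pos _ (hvis p hp).mem
  obtain ⟨S, Q, -, hQ, hS, hlink⟩ := hLH (closure (N \ E) ∩ Metric.thickening 1 B)
    inter_subset_left (hBb.thickening.subset inter_subset_right)
  have hlt : ∀ x ∈ N ∪ E, (σ x : ℝ≥0∞) < G.escapeTime x ∧ G.flow (σ x) x ∈ N ∪ E ∧
      G.flow (σ x) x ∉ L := by
    intro x hx
    by_cases hx0 : x ∈ E ∪ (Metric.thickening 1 B)ᶜ
    · rw [hσ0 x hx0, G.flow_zero]
      refine ⟨G.escapeTime_pos x, hx, fun hxL => ?_⟩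
      have hxE : x ∉ E := fun hxE => hLE.subset ⟨hxL, hxE⟩
      -- A point of `L \ E` visits `L` at time `0`, hence lies in `B`.
      have hxv : (x, (0 : ℝ≥0)) ∈ G.visits (N \ E) L := by
        refine ⟨⟨G.escapeTime_pos x, fun s hs => ?_⟩, ?_⟩
        · rw [nonpos_iff_eq_zero.1 hs, G.flow_zero]
          exact ⟨hLN hxL, hxE⟩
        · rwa [G.flow_zero]
      exact hx0.elim hxE fun h => h (Metric.self_subset_thickening one_pos _ (hvis _ hxv).mem)
    · have hxV : x ∈ Metric.thickening 1 B := not_not.1 fun h => hx0 (Or.inr h)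
      have hxE : x ∉ E := fun h => hx0 (Or.inl h)
      obtain ⟨h1, h2⟩ := hσ x ⟨hx.resolve_right hxE, hxE⟩ hxV
      exact ⟨h1.1, Or.inl (h1.2 _ le_rfl).1, fun hL => h2 _ le_rfl ⟨h1, hL⟩⟩
  have hcont : Continuous fun q : Q => G.flow (σ q) q :=
    G.continuousOn_flow.comp_continuous (f := fun q : Q => (σ q, (q : X))) (by fun_prop)
      fun q => (hlt q (hQ q.2)).1
  obtain ⟨_, hL, q, rfl⟩ := hlink ⟨_, hcont⟩ ⟨fun q => (hlt q (hQ q.2)).2.1, fun q hq => by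
    have hq0 : σ q = 0 :=
      hσ0 _ ((hS hq).imp_right fun h hV => h.2 ⟨h.1, hV⟩)
    change G.flow (σ q) q = q
    rw [hq0, G.flow_zero]⟩
  exact (hlt q (hQ q.2)).2.2 hL
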